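/- Let $\mathbb{T}$ be the unit circle and let $m$ be normalized arc length measure $d\theta/(2\pi)$ on $\mathbb{T}$. Let $\mu$ be a finite complex Borel measure on $\mathbb{T}$ whose Fourier coefficients $\widehat{\mu}(k)=\int_{\mathbb{T}} e^{-ik\theta}\,d\mu(e^{i\theta})$, $k\in\mathbb{Z}$, satisfy $\widehat{\mu}(k)=0$ for all $k<0$. Then $\mu$ is absolutely continuous with respect to $m$. Moreover, let \[f(z)=\int_{\mathbb{T}}\frac{1-|z|^2}{|e^{i\theta}-z|^2}\,d\mu(e^{i\theta}),\qquad |z|<1,\] be the Poisson extension of $\mu$ and set $f_r(e^{i\theta})=f(re^{i\theta})$ for $0\le r<1$. Then: 1. $f$ belongs to the Hardy space $H^1(\mathbb{D})$, that is, $f$ is analytic in the open unit disc $\mathbb{D}$ and $\sup_{0\le r<1}\int_{\mathbb{T}}|f_r|\,dm<\infty$; 2. $(f_r)$ is Cauchy in $L^1(\mathbb{T})$ as $r\to1^-$: for every $\varepsilon>0$ there is $R\in[0,1)$ such that $\int_{\mathbb{T}}|f_r-f_\varrho|\,dm<\varepsilon$ for all $r,\varrho\in[R,1)$; 3. there is a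 function $f^\ast\in L^1(\mathbb{T})$ such that $\int_{\mathbb{T}}|f_r-f^\ast|\,dm\to0$ as $r\to1^-$, such that $\int_{\mathbb{T}}f^\ast(e^{i\theta})e^{-ik\theta}\,dm=\widehat{\mu}(k)$ for all $k\in\mathbb{Z}$, and such that $d\mu=f^\ast\,dm$. -/

import Mathlib

open MeasureTheory Filter Topology
open scoped ENNReal NNReal

noncomputable section

/-- The unit circle carries its Borel sigma-algebra. -/
instance Circle.instMeasurableSpaceBorel : MeasurableSpace Circle := borel Circle

instance Circle.instBorelSpaceBorel : BorelSpace Circle := ⟨rfl⟩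

namespace FMRiesz

/-- Normalized arc length on the unit circle: the image of `dθ / (2π)` on `(0, 2π]` under
`θ ↦ exp (iθ)`. -/
def arcLength : Measure Circle :=
  (ENNReal.ofReal (2 * Real.pi))⁻¹ •
    (volume.restrict (Set.Ioc (0 : ℝ) (2 * Real.pi))).map Circle.exp

/-- The Fourier coefficient `∫ e^{-ikθ} dμ(e^{iθ})` of a complex Borel measure on the circle. -/
def fourierCoeffMeasure (μ : ComplexMeasure Circle) (k : ℤ) : ℂ :=
  μ.integral (fun w : Circle => (w : ℂ) ^ (-k)) (ContinuousLinearMap.mul ℝ ℂ)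

/-- The Fourier coefficient `∫ f(e^{iθ}) e^{-ikθ} dθ/(2π)` of a function on the circle. -/
def fourierCoeffFun (f : Circle → ℂ) (k : ℤ) : ℂ :=
  ∫ w : Circle, (w : ℂ) ^ (-k) * f w ∂arcLength

/-- The Poisson extension `z ↦ ∫ (1 - |z|²) / |e^{iθ} - z|² dμ(e^{iθ})` of a complex Borel measure
on the circle. -/
def poissonExtension (μ : ComplexMeasure Circle) (z : ℂ) : ℂ :=
  μ.integral (fun w : Circle => (1 - ‖z‖ ^ 2) / ‖(w : ℂ) - z‖ ^ 2) (ContinuousLinearMap.lsmul ℝ ℝ)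

/-- The circle restriction `f_r(e^{iθ}) = f(r e^{iθ})`. -/
def circleRestriction (f : ℂ → ℂ) (r : ℝ) (w : Circle) : ℂ := f (r * w)

/-- The Hardy space `H¹` of the unit disc: analytic functions in the disc whose means
`∫ |f(r e^{iθ})| dθ/(2π)`, `0 ≤ r < 1`, are bounded. -/
structure MemHardyOne (f : ℂ → ℂ) : Prop where
  analyticOn : AnalyticOnNhd ℂ f (Metric.ball 0 1)
  bounded : ∃ C : ℝ≥0, ∀ r : ℝ, 0 ≤ r → r < 1 → eLpNorm (circleRestriction f r) 1 arcLength ≤ C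

end FMRiesz

end

/-!
The argument has two halves.

*Absolute continuity* follows Øksendal's elementary proof. Write `dμ = H dν` with `ν` a finite
positive measure (`exists_eq_withDensityᵥ`). Vanishing of the Fourier coefficients of negative index
says that `H dν` annihilates `w, w², w³, …`, and this is inherited when `H` is multiplied by a
rational function with poles outside the closed disc: for a factor `1 / (w - b)` the new
moments satisfy `I (n + 1) = b * I n` and are bounded, so they vanish as `1 < |b|`
(`AnnihilatesPowers.inv_sub_mul`). A compact null set `K` is covered by discs `B(aᵢ, rᵢ)` with
`∑ rᵢ` tiny, and suitable products of factors `(w - aᵢ) / (w - (1 + ρᵢ) aᵢ)` are bounded by `1` and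
converge to the indicator of the complement of `K`
(`AnnihilatesPowers.exists_approx_indicator_compl`). Dominated convergence gives `∫_K w H dν = 0`,
and inner regularity extends this to all null Borel sets (`AnnihilatesPowers.setIntegral_eq_zero`).

*Boundary behaviour.* By the Radon–Nikodym theorem `dμ = f dm` with `f` integrable, so the Poisson
extension of `μ` is the Poisson integral of `f`. Poisson means contract the `L¹` norm
(`eLpNorm_poissonMean_le`) and converge to `f` in `L¹` (`tendsto_eLpNorm_poissonMean_sub`), which
gives the bound on the means, the Cauchy property and the limit. Since `f dm` annihilates the
antianalytic part of the Poisson kernel, its Poisson integral is a Cauchy integral, hence analytic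
(`AnnihilatesPowers.integral_poisson_smul`, `analyticOnNhd_cauchyIntegral_arcLength`).
-/

namespace FMRiesz

/-! ### Complex measures with a density -/

section ComplexMeasure

variable {X : Type*} [MeasurableSpace X]

/-- The Radon–Nikodym theorem for complex measures, from its signed version applied to the real
and imaginary parts. -/
theorem withDensityᵥ_rnDeriv_eq (μ : ComplexMeasure X) (ν : Measure X) [SigmaFinite ν]
    (h : VectorMeasure.AbsolutelyContinuous μ ν.toENNRealVectorMeasure) :
    ν.withDensityᵥ (μ.rnDeriv ν) = μ := by
  obtain ⟨hre, him⟩ := (ComplexMeasure.absolutelyContinuous_ennreal_iff _ _).1 h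
  have hi := μ.integrable_rnDeriv ν
  ext s hs
  rw [withDensityᵥ_apply hi hs]
  apply Complex.ext
  · have := congrArg (fun m : SignedMeasure X => m s)
      (SignedMeasure.withDensityᵥ_rnDeriv_eq _ ν hre)
    simp only [withDensityᵥ_apply (SignedMeasure.integrable_rnDeriv _ _) hs] at this
    rw [← RCLike.re_eq_complex_re, ← integral_re hi.integrableOn]
    exact this
  · have := congrArg (fun m : SignedMeasure X => m s)
      (SignedMeasure.withDensityᵥ_rnDeriv_eq _ ν him)
    simp only [withDensityᵥ_apply (SignedMeasure.integrable_rnDeriv _ _) hs] at this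
    rw [← RCLike.im_eq_complex_im, ← integral_im hi.integrableOn]
    exact this

/-- A complex measure has an integrable density with respect to the sum of the total variations of
its real and imaginary parts, which is a finite positive measure. -/
theorem exists_eq_withDensityᵥ (μ : ComplexMeasure X) :
    ∃ (ν : Measure X) (h : X → ℂ), IsFiniteMeasure ν ∧ Integrable h ν ∧ μ = ν.withDensityᵥ h := by
  let ν : Measure X := (ComplexMeasure.re μ).totalVariation + (ComplexMeasure.im μ).totalVariation
  refine ⟨ν, μ.rnDeriv ν, inferInstance, μ.integrable_rnDeriv ν, ?_⟩
  symm
  apply withDensityᵥ_rnDeriv_eq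
  rw [ComplexMeasure.absolutelyContinuous_ennreal_iff]
  constructor <;>
  · refine VectorMeasure.AbsolutelyContinuous.mk fun s hs hs0 => ?_
    rw [Measure.toENNRealVectorMeasure_apply_measurable hs, Measure.add_apply, add_eq_zero] at hs0
    apply SignedMeasure.null_of_totalVariation_zero
    first | exact hs0.1 | exact hs0.2

/-- For a bounded integrand, the integral against a vector measure given by a density is a Bochner
integral against the underlying positive measure. -/
theorem integral_withDensityᵥ {E F G : Type*} [NormedAddCommGroup E] [NormedSpace ℝ E]
    [NormedAddCommGroup F] [NormedSpace ℝ F] [CompleteSpace F]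
    [NormedAddCommGroup G] [NormedSpace ℝ G] [CompleteSpace G] (B : E →L[ℝ] F →L[ℝ] G)
    {ν : Measure X} {h : X → F} (hh : Integrable h ν) {f : X → E} (hf : StronglyMeasurable f)
    {C : ℝ} (hC : ∀ x, ‖f x‖ ≤ C) :
    (ν.withDensityᵥ h).integral f B = ∫ x, B (f x) (h x) ∂ν := by
  have hvar := Measure.variation_withDensityᵥ hh
  have : IsFiniteMeasure (ν.withDensityᵥ h).variation := by
    rw [hvar]; exact ⟨by simpa using! hh.2⟩
  have hint : ∀ g : X → E, StronglyMeasurable g → ∀ c : ℝ, (∀ x, ‖g x‖ ≤ c) →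
      Integrable (fun x => B (g x) (h x)) ν := by
    intro g hg c hc
    refine (hh.norm.const_mul (‖B‖ * c)).mono' ?_ (.of_forall fun x => ?_)
    · exact B.aestronglyMeasurable_comp₂ hg.aestronglyMeasurable hh.aestronglyMeasurable
    · refine (B.le_opNorm₂ _ _).trans ?_
      gcongr
      exact hc x
  have hsimple : ∀ g : SimpleFunc X E,
      (ν.withDensityᵥ h).integral g B = ∫ x, B (g x) (h x) ∂ν := by
    intro g
    induction g using SimpleFunc.induction with
    | @const c s hs =>
      simp only [SimpleFunc.coe_piecewise, SimpleFunc.coe_const, Function.const_zero,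
        Set.piecewise_eq_indicator]
      rw [show (Function.const X c) = fun _ => c from rfl,
        VectorMeasure.integral_indicator_const _ hs, withDensityᵥ_apply hh hs,
        ← ContinuousLinearMap.integral_comp_comm _ hh.integrableOn, ← integral_indicator hs]
      congr with x
      by_cases hx : x ∈ s <;> simp [hx]
    | @add f g hd h1 h2 =>
      obtain ⟨c, hc⟩ := f.exists_forall_norm_le
      obtain ⟨d, hd⟩ := g.exists_forall_norm_le
      rw [SimpleFunc.coe_add, VectorMeasure.integral_add f.integrable_of_isFiniteMeasure
        g.integrable_of_isFiniteMeasure, h1, h2, ← integral_add (hint f f.stronglyMeasurable c hc)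
        (hint g g.stronglyMeasurable d hd)]
      simp
  have hC0 : ∀ x : X, 0 ≤ C := fun x => (norm_nonneg _).trans (hC x)
  rcases isEmpty_or_nonempty X with hX | ⟨⟨x0⟩⟩
  · have : ν = 0 := Measure.eq_zero_of_isEmpty ν
    subst this
    simp [VectorMeasure.integral_of_isEmpty]
  have hb := hf.norm_approxBounded_le (hC0 x0)
  have t1 : Tendsto (fun n => (ν.withDensityᵥ h).integral (hf.approxBounded C n) B) atTop
      (𝓝 ((ν.withDensityᵥ h).integral f B)) :=
    VectorMeasure.tendsto_integral_of_dominated_convergence (fun _ => C)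
    (fun n => (hf.approxBounded C n).aestronglyMeasurable) (integrable_const _)
    (fun n => .of_forall fun x => hb n x)
    (.of_forall fun x => hf.tendsto_approxBounded_of_norm_le (hC x))
  have t2 : Tendsto (fun n => ∫ x, B (hf.approxBounded C n x) (h x) ∂ν) atTop
      (𝓝 (∫ x, B (f x) (h x) ∂ν)) := by
    refine MeasureTheory.tendsto_integral_of_dominated_convergence (fun x => ‖B‖ * C * ‖h x‖)
      (fun n => (hint _ (hf.approxBounded C n).stronglyMeasurable C (hb n)).aestronglyMeasurable)
      (hh.norm.const_mul _) (fun n => .of_forall fun x => ?_) (.of_forall fun x => ?_)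
    · refine (B.le_opNorm₂ _ _).trans ?_
      gcongr
      exact hb n x
    · exact (((B.flip (h x)).continuous.tendsto _).comp
        (hf.tendsto_approxBounded_of_norm_le (hC x)))
  simp only [hsimple] at t1
  exact tendsto_nhds_unique t1 t2

end ComplexMeasure

/-! ### Null sets of the circle and coverings by small discs -/

/-- A compact set of one-dimensional Hausdorff measure zero is covered by finitely many balls,
centred on it, with small sum of radii. -/
theorem exists_finite_ball_cover_of_hausdorffMeasure_eq_zero {X : Type*} [Nonempty X]
    [MetricSpace X] [MeasurableSpace X] [BorelSpace X] {K : Set X} (hK : IsCompact K)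
    (h0 : Measure.hausdorffMeasure 1 K = 0) {ε : ℝ} (hε : 0 < ε) :
    ∃ (s : Finset ℕ) (a : ℕ → X) (r : ℕ → ℝ), (∀ i ∈ s, a i ∈ K) ∧ (∀ i, 0 < r i) ∧
      K ⊆ ⋃ i ∈ s, Metric.ball (a i) (r i) ∧ ∑ i ∈ s, r i < ε := by
  classical
  rcases K.eq_empty_or_nonempty with rfl | ⟨k₀, hk₀⟩
  · exact ⟨∅, fun _ => Classical.arbitrary X, fun _ => 1, by simp, by simp, by simp,
      by simpa using hε⟩
  have hε2 : 0 < ENNReal.ofReal (ε / 2) := by simpa using hε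
  rw [Measure.hausdorffMeasure_apply] at h0
  have h1 := (le_iSup₂ (f := fun (r : ℝ≥0∞) (_ : 0 < r) =>
    ⨅ (t : ℕ → Set X) (_ : K ⊆ ⋃ n, t n) (_ : ∀ n, Metric.ediam (t n) ≤ r),
          ∑' n, ⨆ _ : (t n).Nonempty, Metric.ediam (t n) ^ (1 : ℝ)) 1 one_pos).trans h0.le
  obtain ⟨t, ht⟩ := iInf_lt_iff.1 (h1.trans_lt hε2)
  obtain ⟨htK, ht⟩ := iInf_lt_iff.1 ht
  obtain ⟨htd, ht⟩ := iInf_lt_iff.1 ht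
  obtain ⟨δ, hδ, hδsum⟩ := ENNReal.exists_pos_sum_of_countable hε2.ne' ℕ
  have hfin : ∀ n, Metric.ediam (t n) ≠ ∞ := fun n => ((htd n).trans_lt (by simp)).ne
  let r : ℕ → ℝ := fun n => Metric.diam (t n) + δ n
  -- Sets of the cover that miss `K` get the arbitrary centre `k₀`.
  let a : ℕ → X := fun n => if h : (t n ∩ K).Nonempty then h.some else k₀
  have haK : ∀ n, a n ∈ K := fun n => by
    by_cases h : (t n ∩ K).Nonempty
    · simpa only [a, dif_pos h] using h.some_mem.2
    · simpa only [a, dif_neg h] using hk₀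
  have hr : ∀ n, 0 < r n := fun n =>
    add_pos_of_nonneg_of_pos Metric.diam_nonneg (by exact_mod_cast hδ n)
  have hcov : K ⊆ ⋃ n, Metric.ball (a n) (r n) := by
    intro x hx
    obtain ⟨n, hn⟩ := Set.mem_iUnion.1 (htK hx)
    refine Set.mem_iUnion.2 ⟨n, ?_⟩
    have h : (t n ∩ K).Nonempty := ⟨x, hn, hx⟩
    have ha : a n ∈ t n := by simpa only [a, dif_pos h] using h.some_mem.1
    rw [Metric.mem_ball]
    have hbd := Metric.isBounded_iff_ediam_ne_top.2 (hfin n)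
    refine (Metric.dist_le_diam_of_mem hbd hn ha).trans_lt ?_
    have : (0 : ℝ) < δ n := by exact_mod_cast hδ n
    simp only [r]; linarith
  obtain ⟨s, hs⟩ := hK.elim_finite_subcover _ (fun n => Metric.isOpen_ball) hcov
  refine ⟨s, a, r, fun i _ => haK i, hr, hs, ?_⟩
  have hle : ∀ n, ENNReal.ofReal (r n) ≤
      (⨆ _ : (t n).Nonempty, Metric.ediam (t n) ^ (1 : ℝ)) + δ n := fun n => by
    simp only [r]
    rw [ENNReal.ofReal_add Metric.diam_nonneg (δ n).coe_nonneg, ENNReal.ofReal_coe_nnreal]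
    gcongr
    rw [Metric.diam, ENNReal.ofReal_toReal (hfin n)]
    rcases (t n).eq_empty_or_nonempty with h | h
    · simp [h]
    · simp [h]
  have : ENNReal.ofReal (∑ i ∈ s, r i) < ENNReal.ofReal ε := by
    rw [ENNReal.ofReal_sum_of_nonneg fun i _ => (hr i).le]
    calc _ ≤ ∑ n ∈ s, ((⨆ _ : (t n).Nonempty, Metric.ediam (t n) ^ (1 : ℝ)) + δ n) :=
          Finset.sum_le_sum fun n _ => hle n
      _ ≤ ∑' n, ((⨆ _ : (t n).Nonempty, Metric.ediam (t n) ^ (1 : ℝ)) + δ n) :=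
          ENNReal.sum_le_tsum _
      _ = _ := ENNReal.tsum_add
      _ < ENNReal.ofReal (ε / 2) + ENNReal.ofReal (ε / 2) := ENNReal.add_lt_add ht hδsum
      _ = ENNReal.ofReal ε := by rw [← ENNReal.ofReal_add (by positivity) (by positivity)]; simp
  exact (ENNReal.ofReal_lt_ofReal_iff hε).1 this

theorem circle_dist_eq_norm_sub (w a : Circle) : dist w a = ‖(w : ℂ) - a‖ :=
  (Subtype.dist_eq w a).trans (dist_eq_norm _ _)

theorem lipschitzWith_circleExp : LipschitzWith 1 Circle.exp := by
  refine LipschitzWith.of_dist_le_mul fun x y => ?_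
  have := (lipschitzWith_circleMap 0 1).dist_le_mul x y
  rw [circle_dist_eq_norm_sub, ← dist_eq_norm]
  simpa only [circleMap, zero_add, Complex.ofReal_one, one_mul, ← Circle.coe_exp, abs_one,
    Real.nnabs_of_nonneg zero_le_one, Real.toNNReal_one] using this

theorem arcLength_apply {s : Set Circle} (hs : MeasurableSet s) :
    arcLength s = (ENNReal.ofReal (2 * Real.pi))⁻¹ *
      volume (Circle.exp ⁻¹' s ∩ Set.Ioc 0 (2 * Real.pi)) := by
  have hm : Measurable Circle.exp := Circle.exp.continuous.measurable
  rw [arcLength, Measure.smul_apply, Measure.map_apply hm hs, Measure.restrict_apply (hm hs),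
    smul_eq_mul]

instance : IsProbabilityMeasure arcLength := by
  constructor
  rw [arcLength_apply MeasurableSet.univ]
  simp only [Set.preimage_univ, Set.univ_inter, Real.volume_Ioc, sub_zero]
  exact ENNReal.inv_mul_cancel (by simp [Real.pi_pos]) ENNReal.ofReal_ne_top

theorem exists_mem_Ioc_circleExp_eq (w : Circle) :
    ∃ θ ∈ Set.Ioc (0 : ℝ) (2 * Real.pi), Circle.exp θ = w := by
  obtain ⟨x, rfl⟩ := Circle.exp_surjective w
  obtain ⟨y, hy, hxy⟩ := Circle.periodic_exp.exists_mem_Ioc Real.two_pi_pos x 0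
  exact ⟨y, by simpa using hy, hxy.symm⟩

/-- Arc-length null sets have Hausdorff measure zero because `θ ↦ exp (iθ)` is a contraction. -/
theorem hausdorffMeasure_eq_zero_of_arcLength_eq_zero {s : Set Circle} (hs : MeasurableSet s)
    (h0 : arcLength s = 0) : Measure.hausdorffMeasure 1 s = 0 := by
  rw [arcLength_apply hs, mul_eq_zero, ENNReal.inv_eq_zero, or_iff_right ENNReal.ofReal_ne_top,
    ← hausdorffMeasure_real] at h0
  have h := lipschitzWith_circleExp.hausdorffMeasure_image_le zero_le_one
    (Circle.exp ⁻¹' s ∩ Set.Ioc 0 (2 * Real.pi))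
  rw [h0, mul_zero] at h
  refine measure_mono_null (fun w hw => ?_) (le_antisymm h bot_le)
  obtain ⟨θ, hθ, rfl⟩ := exists_mem_Ioc_circleExp_eq w
  exact ⟨θ, ⟨hw, hθ⟩, rfl⟩

/-! ### Measures annihilating the positive powers -/

/-- The density `H` is integrable with respect to `ν`, and the complex measure `H dν` annihilates
`w, w², w³, …`, that is, its Fourier coefficients of negative index vanish. -/
structure AnnihilatesPowers (ν : Measure Circle) (H : Circle → ℂ) : Prop where
  integrable : Integrable H ν
  integral_eq_zero : ∀ n : ℕ, ∫ w : Circle, (w : ℂ) ^ (n + 1) * H w ∂ν = 0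

theorem integrable_continuous_mul {ν : Measure Circle} {H : Circle → ℂ} (hH : Integrable H ν)
    {g : Circle → ℂ} (hg : Continuous g) : Integrable (fun w => g w * H w) ν := by
  obtain ⟨C, hC⟩ := isCompact_univ.exists_bound_of_continuousOn hg.continuousOn
  exact hH.bdd_mul hg.aestronglyMeasurable (c := C) (.of_forall fun x => hC x trivial)

namespace AnnihilatesPowers

variable {ν : Measure Circle} {H : Circle → ℂ}

theorem sub_mul (h : AnnihilatesPowers ν H) (a : ℂ) :
    AnnihilatesPowers ν (fun w => ((w : ℂ) - a) * H w) := by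
  refine ⟨integrable_continuous_mul h.integrable (by fun_prop), fun n => ?_⟩
  have h1 := integrable_continuous_mul h.integrable
    (g := fun w : Circle => (w : ℂ) ^ (n + 2)) (by fun_prop)
  have h2 := integrable_continuous_mul h.integrable
    (g := fun w : Circle => (w : ℂ) ^ (n + 1)) (by fun_prop)
  calc _ = ∫ w : Circle, ((w : ℂ) ^ (n + 2) * H w - a * ((w : ℂ) ^ (n + 1) * H w)) ∂ν := by
        congr with w; ring
    _ = 0 := by
        rw [integral_sub h1 (h2.const_mul a), integral_const_mul, h.integral_eq_zero (n + 1),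
          h.integral_eq_zero n]
        simp

theorem inv_sub_mul (h : AnnihilatesPowers ν H) {b : ℂ} (hb : 1 < ‖b‖) :
    AnnihilatesPowers ν (fun w => ((w : ℂ) - b)⁻¹ * H w) := by
  have hne : ∀ w : Circle, (w : ℂ) - b ≠ 0 := fun w h0 => by
    rw [← sub_eq_zero.1 h0, Circle.norm_coe] at hb
    exact lt_irrefl _ hb
  have hi : Integrable (fun w : Circle => ((w : ℂ) - b)⁻¹ * H w) ν :=
    integrable_continuous_mul h.integrable
      (Continuous.inv₀ (by fun_prop) hne)
  refine ⟨hi, ?_⟩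
  set G : Circle → ℂ := fun w => ((w : ℂ) - b)⁻¹ * H w
  set I : ℕ → ℂ := fun n => ∫ w : Circle, (w : ℂ) ^ (n + 1) * G w ∂ν with hI
  have hp : ∀ n : ℕ, Integrable (fun w : Circle => (w : ℂ) ^ (n + 1) * G w) ν := fun n =>
    integrable_continuous_mul hi (g := fun w : Circle => (w : ℂ) ^ (n + 1)) (by fun_prop)
  -- The moments `I n` grow geometrically with ratio `b`, yet they are bounded, so they vanish.
  have hrec : ∀ n, I (n + 1) = b * I n := fun n => by
    rw [← sub_eq_zero, ← h.integral_eq_zero n, hI]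
    simp only
    rw [← integral_const_mul, ← integral_sub (hp _) ((hp _).const_mul b)]
    congr with w
    simp only [G]
    field_simp [hne w]
    ring
  have hbd : ∀ n, ‖I n‖ ≤ ∫ w, ‖G w‖ ∂ν := fun n => by
    refine (norm_integral_le_integral_norm _).trans_eq ?_
    congr with w
    rw [norm_mul, norm_pow, Circle.norm_coe, one_pow, one_mul]
  have hpow : ∀ n m, I (n + m) = b ^ m * I n := fun n m => by
    induction m with
    | zero => simp
    | succ m ih => rw [← add_assoc, hrec, ih]; ring
  intro n
  change I n = 0
  by_contra h0
  have htop : Tendsto (fun m : ℕ => ‖b‖ ^ m * ‖I n‖) atTop atTop :=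
    (tendsto_pow_atTop_atTop_of_one_lt hb).atTop_mul_const (norm_pos_iff.2 h0)
  obtain ⟨m, hm⟩ := (htop.eventually_gt_atTop (∫ w, ‖G w‖ ∂ν)).exists
  have := hbd (n + m)
  rw [hpow, norm_mul, norm_pow] at this
  linarith

theorem prod_mul (h : AnnihilatesPowers ν H) {ι : Type*} (s : Finset ι) (a b : ι → ℂ)
    (hb : ∀ i ∈ s, 1 < ‖b i‖) :
    AnnihilatesPowers ν (fun w => (∏ i ∈ s, ((w : ℂ) - a i) / ((w : ℂ) - b i)) * H w) := by
  classical
  induction s using Finset.induction_on with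
  | empty => simpa using h
  | insert i s his ih =>
    have := ((ih fun j hj => hb j (Finset.mem_insert_of_mem hj)).sub_mul (a i)).inv_sub_mul
      (hb i (Finset.mem_insert_self i s))
    convert this using 2 with w
    rw [Finset.prod_insert his]
    ring

end AnnihilatesPowers

/-! ### Analytic functions separating a compact null set from its complement -/

/-- A finite product of points of the closed unit disc is close to `1` when its factors are. -/
theorem norm_prod_sub_one_le {ι : Type*} (s : Finset ι) (x : ι → ℂ) (hx : ∀ i ∈ s, ‖x i‖ ≤ 1) :
    ‖∏ i ∈ s, x i - 1‖ ≤ ∑ i ∈ s, ‖x i - 1‖ := by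
  classical
  induction s using Finset.induction_on with
  | empty => simp
  | insert i s his ih =>
    rw [Finset.prod_insert his, Finset.sum_insert his]
    have hx' : ∀ j ∈ s, ‖x j‖ ≤ 1 := fun j hj => hx j (Finset.mem_insert_of_mem hj)
    calc ‖x i * ∏ j ∈ s, x j - 1‖ = ‖(x i - 1) + x i * (∏ j ∈ s, x j - 1)‖ := by ring_nf
      _ ≤ ‖x i - 1‖ + ‖x i‖ * ‖∏ j ∈ s, x j - 1‖ := by
          rw [← norm_mul]; exact norm_add_le _ _
      _ ≤ ‖x i - 1‖ + 1 * ∑ j ∈ s, ‖x j - 1‖ := by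
          gcongr
          · exact hx i (Finset.mem_insert_self i s)
          · exact ih hx'
      _ = _ := by rw [one_mul]

/-- Moving a boundary point `a` radially outwards increases its distance from every point of the
circle. -/
theorem norm_sub_le_norm_sub_real_mul (w a : Circle) {ρ : ℝ} (hρ : 0 ≤ ρ) :
    ‖(w : ℂ) - a‖ ≤ ‖(w : ℂ) - (1 + ρ : ℝ) * a‖ := by
  have hw : Complex.normSq w = 1 := Circle.normSq_coe w
  have ha : Complex.normSq a = 1 := Circle.normSq_coe a
  have h : Complex.normSq ((w : ℂ) - a) ≤ Complex.normSq ((w : ℂ) - (1 + ρ : ℝ) * a) := by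
    rw [Complex.normSq_apply] at *
    rw [Complex.normSq_apply] at *
    simp only [Complex.sub_re, Complex.sub_im, Complex.mul_re, Complex.mul_im, Complex.ofReal_re,
      Complex.ofReal_im, zero_mul, sub_zero, add_zero]
    have h1 : (w : ℂ).re * (a : ℂ).re + (w : ℂ).im * (a : ℂ).im ≤ 1 := by
      nlinarith [sq_nonneg ((w : ℂ).re - (a : ℂ).re), sq_nonneg ((w : ℂ).im - (a : ℂ).im)]
    nlinarith [mul_nonneg hρ (sub_nonneg.2 h1), sq_nonneg ρ]
  rw [Complex.normSq_eq_norm_sq, Complex.normSq_eq_norm_sq] at h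
  exact (sq_le_sq₀ (norm_nonneg _) (norm_nonneg _)).1 h

/-- Øksendal's functions: products of factors `(w - aᵢ) / (w - (1 + ρᵢ) aᵢ)`, which are small on a
prescribed compact null set `K`, close to `1` away from `K`, and bounded by `1` on the circle.
Multiplication by them preserves annihilation of the positive powers because their poles lie
outside the closed disc. -/
theorem AnnihilatesPowers.exists_approx_indicator_compl {ν : Measure Circle} {H : Circle → ℂ}
    (h : AnnihilatesPowers ν H) {K : Set Circle} (hK : IsCompact K) (h0 : arcLength K = 0)
    {ε : ℝ} (hε : 0 < ε) :
    ∃ g : Circle → ℂ, Continuous g ∧ (∀ w, ‖g w‖ ≤ 1) ∧ (∀ w ∈ K, ‖g w‖ ≤ ε) ∧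
      (∀ w, ∀ d > 0, (∀ a ∈ K, d ≤ dist w a) → ‖g w - 1‖ ≤ ε / d) ∧
      AnnihilatesPowers ν (fun w => g w * H w) := by
  obtain ⟨s, a, r, haK, hr, hcov, hsum⟩ := exists_finite_ball_cover_of_hausdorffMeasure_eq_zero hK
    (hausdorffMeasure_eq_zero_of_arcLength_eq_zero hK.measurableSet h0) (mul_pos hε hε)
  -- A factor is at most `rᵢ / ρᵢ = ε` on its disc, while `∑ rᵢ < ε²` gives `∑ ρᵢ < ε`, which
  -- bounds the distance of the product from `1` away from `K`.
  let ρ : ℕ → ℝ := fun i => r i / ε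
  have hρ : ∀ i, 0 < ρ i := fun i => div_pos (hr i) hε
  let b : ℕ → ℂ := fun i => (1 + ρ i : ℝ) * (a i : ℂ)
  have hb : ∀ i, 1 < ‖b i‖ := fun i => by
    simp only [b, norm_mul, Circle.norm_coe, mul_one, Complex.norm_real, Real.norm_eq_abs]
    rw [abs_of_pos (by linarith [hρ i])]
    linarith [hρ i]
  have hab : ∀ i, ‖(a i : ℂ) - b i‖ = ρ i := fun i => by
    have : (a i : ℂ) - b i = -((ρ i : ℝ) * (a i : ℂ)) := by simp only [b]; push_cast; ring
    rw [this, norm_neg, norm_mul, Circle.norm_coe, mul_one, Complex.norm_real,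
      Real.norm_of_nonneg (hρ i).le]
  have hne : ∀ i (w : Circle), (w : ℂ) - b i ≠ 0 := fun i w h0 => by
    have := hb i
    rw [← sub_eq_zero.1 h0, Circle.norm_coe] at this
    exact lt_irrefl _ this
  have hwb : ∀ i (w : Circle), ρ i ≤ ‖(w : ℂ) - b i‖ := fun i w => by
    have h1 : ‖b i‖ = 1 + ρ i := by
      simp only [b, norm_mul, Circle.norm_coe, mul_one, Complex.norm_real]
      exact Real.norm_of_nonneg (by linarith [hρ i])
    have h2 := norm_sub_norm_le (b i) w
    rw [h1, Circle.norm_coe, norm_sub_rev] at h2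
    linarith
  let x : ℕ → Circle → ℂ := fun i w => ((w : ℂ) - a i) / ((w : ℂ) - b i)
  have hx1 : ∀ i w, ‖x i w‖ ≤ 1 := fun i w => by
    simp only [x, norm_div]
    exact div_le_one_of_le₀ (norm_sub_le_norm_sub_real_mul w (a i) (hρ i).le) (norm_nonneg _)
  refine ⟨fun w => ∏ i ∈ s, x i w, ?_, fun w => ?_, fun w hw => ?_, fun w d hd hwd => ?_,
    h.prod_mul s (fun i => a i) b fun i _ => hb i⟩
  · exact continuous_finsetProd _ fun i _ => Continuous.div (by fun_prop) (by fun_prop) (hne i)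
  · rw [norm_prod]
    exact Finset.prod_le_one (fun i _ => norm_nonneg _) fun i _ => hx1 i w
  · obtain ⟨i, hi, hwi⟩ := Set.mem_iUnion₂.1 (hcov hw)
    rw [norm_prod, ← Finset.mul_prod_erase s _ hi]
    have h1 : ‖x i w‖ ≤ ε := by
      simp only [x, norm_div]
      rw [div_le_iff₀ (norm_pos_iff.2 (hne i w))]
      calc ‖(w : ℂ) - a i‖ = dist w (a i) := (circle_dist_eq_norm_sub w (a i)).symm
        _ ≤ r i := (Metric.mem_ball.1 hwi).le
        _ = ε * ρ i := by simp only [ρ]; field_simp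
        _ ≤ _ := by gcongr; exact hwb i w
    calc _ ≤ ε * 1 := by
          gcongr
          exact Finset.prod_le_one (fun i _ => norm_nonneg _) fun i _ => hx1 i w
      _ = ε := mul_one ε
  · refine (norm_prod_sub_one_le s _ fun i _ => hx1 i w).trans ?_
    calc _ ≤ ∑ i ∈ s, ρ i / d := by
          refine Finset.sum_le_sum fun i hi => ?_
          have : x i w - 1 = -((a i : ℂ) - b i) / ((w : ℂ) - b i) := by
            simp only [x]; field_simp [hne i w]; ring
          rw [this, norm_div, norm_neg, hab]
          gcongr
          · exact (hρ i).le
          · refine le_trans ?_ (norm_sub_le_norm_sub_real_mul w (a i) (hρ i).le)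
            rw [← circle_dist_eq_norm_sub]
            exact hwd _ (haK i hi)
      _ = (∑ i ∈ s, r i) / ε / d := by simp only [ρ, Finset.sum_div]
      _ ≤ (ε * ε) / ε / d := by gcongr
      _ = ε / d := by field_simp

/-- The density `w * H w` has no mass on a compact null set `K`: its integral over `Kᶜ` is a limit
of integrals that vanish, and so does its integral over the whole circle. -/
theorem AnnihilatesPowers.setIntegral_eq_zero_of_isCompact {ν : Measure Circle} {H : Circle → ℂ}
    (h : AnnihilatesPowers ν H) {K : Set Circle} (hK : IsCompact K) (h0 : arcLength K = 0) :
    ∫ w in K, (w : ℂ) * H w ∂ν = 0 := by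
  have hpos : ∀ n : ℕ, (0 : ℝ) < 1 / ((n : ℝ) + 1) := fun n => Nat.one_div_pos_of_nat
  choose g hgc hg1 hgK hgd hg using fun n : ℕ => h.exists_approx_indicator_compl hK h0 (hpos n)
  have hwH : Integrable (fun w : Circle => (w : ℂ) * H w) ν :=
    integrable_continuous_mul h.integrable (g := fun w : Circle => (w : ℂ)) (by fun_prop)
  have hz : ∀ n, ∫ w, g n w * ((w : ℂ) * H w) ∂ν = 0 := fun n => by
    have := (hg n).integral_eq_zero 0
    simp only [zero_add, pow_one] at this
    rw [← this]
    congr with w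
    ring
  have hto : Tendsto (fun n => ∫ w, g n w * ((w : ℂ) * H w) ∂ν) atTop
      (𝓝 (∫ w, Kᶜ.indicator (fun w : Circle => (w : ℂ) * H w) w ∂ν)) := by
    refine tendsto_integral_of_dominated_convergence (fun w => ‖(w : ℂ) * H w‖)
      (fun n => ((hgc n).aestronglyMeasurable.mul hwH.aestronglyMeasurable)) hwH.norm
      (fun n => .of_forall fun w => ?_) (.of_forall fun w => ?_)
    · rw [norm_mul]
      exact mul_le_of_le_one_left (norm_nonneg _) (hg1 n w)
    · by_cases hw : w ∈ K
      · have : Tendsto (fun n => g n w) atTop (𝓝 0) :=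
          squeeze_zero_norm (fun n => hgK n w hw) tendsto_one_div_add_atTop_nhds_zero_nat
        simpa [hw] using this.mul_const ((w : ℂ) * H w)
      · obtain ⟨d, hd, hball⟩ := Metric.isOpen_iff.1 hK.isClosed.isOpen_compl w hw
        have hda : ∀ a ∈ K, d ≤ dist w a := fun a ha => by
          by_contra hlt
          exact hball (Metric.mem_ball'.2 (not_le.1 hlt)) ha
        have h1 : Tendsto (fun n => g n w - 1) atTop (𝓝 0) := by
          refine squeeze_zero_norm (fun n => hgd n w d hd hda) ?_
          simpa using tendsto_one_div_add_atTop_nhds_zero_nat (𝕜 := ℝ).div_const d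
        have h2 : Tendsto (fun n => g n w) atTop (𝓝 1) := by
          simpa using h1.add_const (1 : ℂ)
        simpa [hw] using h2.mul_const ((w : ℂ) * H w)
  simp only [hz] at hto
  have h1 := tendsto_nhds_unique hto tendsto_const_nhds
  rw [integral_indicator hK.measurableSet.compl] at h1
  have h2 := integral_add_compl hK.measurableSet hwH
  have h3 := h.integral_eq_zero 0
  simp only [zero_add, pow_one] at h3
  rwa [h1, h3, add_zero] at h2

theorem setIntegral_eq_zero_of_forall_isCompact {X : Type*} [MeasurableSpace X] [TopologicalSpace X]
    [T2Space X] [BorelSpace X] {ν : Measure X} [IsFiniteMeasure ν]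
    [ν.InnerRegularCompactLTTop] {F : X → ℂ}
    (hF : Integrable F ν) {E : Set X} (hE : MeasurableSet E)
    (h : ∀ K ⊆ E, IsCompact K → ∫ x in K, F x ∂ν = 0) : ∫ x in E, F x ∂ν = 0 := by
  rw [← norm_le_zero_iff]
  refine le_of_forall_pos_le_add fun ε hε => ?_
  obtain ⟨δ, hδ, hδε⟩ := exists_pos_setLIntegral_lt_of_measure_lt hF.hasFiniteIntegral.ne
    (ε := ENNReal.ofReal ε) (by simpa using hε)
  obtain ⟨K, hKE, hK, hKδ⟩ := hE.exists_isCompact_sdiff_lt (measure_ne_top ν E) hδ.ne'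
  have h1 := setIntegral_sdiff hK.measurableSet hF.integrableOn hKE
  rw [h K hKE hK, sub_zero] at h1
  rw [← h1, zero_add, ← ENNReal.ofReal_le_ofReal_iff hε.le, ofReal_norm]
  exact (enorm_integral_le_lintegral_enorm _).trans (hδε _ hKδ).le

/-- The absolute continuity part of the theorem of F. and M. Riesz, for a measure with density `H`
with respect to a finite positive measure `ν`. -/
theorem AnnihilatesPowers.setIntegral_eq_zero {ν : Measure Circle} [IsFiniteMeasure ν]
    {H : Circle → ℂ} (h : AnnihilatesPowers ν H) {E : Set Circle} (hE : MeasurableSet E)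
    (h0 : arcLength E = 0) : ∫ w in E, H w ∂ν = 0 := by
  have hwH : Integrable (fun w : Circle => (w : ℂ) * H w) ν :=
    integrable_continuous_mul h.integrable (g := fun w : Circle => (w : ℂ)) (by fun_prop)
  have hae : (fun w : Circle => (w : ℂ) * H w) =ᵐ[ν.restrict E] 0 := by
    refine hwH.integrableOn.ae_eq_zero_of_forall_setIntegral_eq_zero fun s hs _ => ?_
    rw [Measure.restrict_restrict hs]
    refine setIntegral_eq_zero_of_forall_isCompact hwH (hs.inter hE) fun K hK hKc => ?_
    exact h.setIntegral_eq_zero_of_isCompact hKc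
      (measure_mono_null (hK.trans Set.inter_subset_right) h0)
  refine integral_eq_zero_of_ae ?_
  filter_upwards [hae] with w hw
  simpa using hw

/-! ### Arc length and circle averages -/

theorem coe_circleExp_eq_circleMap (θ : ℝ) : (Circle.exp θ : ℂ) = circleMap 0 1 θ := by
  simp [circleMap, Circle.coe_exp]

theorem absolutelyContinuous_map_circleExp_arcLength :
    (volume.restrict (Set.Ioc (0 : ℝ) (2 * Real.pi))).map Circle.exp ≪ arcLength :=
  Measure.absolutelyContinuous_smul (ENNReal.inv_ne_zero.2 ENNReal.ofReal_ne_top)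

theorem integral_arcLength {E : Type*} [NormedAddCommGroup E] [NormedSpace ℝ E]
    {f : Circle → E} (hf : AEStronglyMeasurable f arcLength) {F : ℂ → E}
    (hF : ∀ w : Circle, F w = f w) : ∫ w, f w ∂arcLength = Real.circleAverage F 0 1 := by
  have hf' := hf.mono_ac absolutelyContinuous_map_circleExp_arcLength
  rw [arcLength, integral_smul_measure, integral_map Circle.exp.continuous.aemeasurable hf',
    Real.circleAverage, intervalIntegral.integral_of_le Real.two_pi_pos.le, ENNReal.toReal_inv,
    ENNReal.toReal_ofReal Real.two_pi_pos.le]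
  simp only [← coe_circleExp_eq_circleMap, hF]

theorem circleIntegrable_of_integrable_arcLength {E : Type*} [NormedAddCommGroup E]
    {f : Circle → E} (hf : Integrable f arcLength) {F : ℂ → E} (hF : ∀ w : Circle, F w = f w) :
    CircleIntegrable F 0 1 := by
  have hm := hf.aestronglyMeasurable.mono_ac absolutelyContinuous_map_circleExp_arcLength
  rw [arcLength, integrable_smul_measure (ENNReal.inv_ne_zero.2 ENNReal.ofReal_ne_top)
    (ENNReal.inv_ne_top.2 (by simp [Real.pi_pos])),
    integrable_map_measure hm Circle.exp.continuous.aemeasurable] at hf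
  rw [CircleIntegrable, intervalIntegrable_iff_integrableOn_Ioc_of_le Real.two_pi_pos.le]
  simp only [← coe_circleExp_eq_circleMap, hF]
  exact hf

/-! ### The Poisson kernel and Poisson means -/

/-- The Poisson kernel of the unit disc at the interior point `z` and the boundary point `w`. -/
noncomputable def poisson (z : ℂ) (w : Circle) : ℝ := (1 - ‖z‖ ^ 2) / ‖(w : ℂ) - z‖ ^ 2

theorem coe_sub_ne_zero (w : Circle) {z : ℂ} (hz : ‖z‖ < 1) : (w : ℂ) - z ≠ 0 := fun h => by
  rw [← sub_eq_zero.1 h, Circle.norm_coe] at hz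
  exact lt_irrefl _ hz

theorem poisson_nonneg {z : ℂ} (hz : ‖z‖ < 1) (w : Circle) : 0 ≤ poisson z w :=
  div_nonneg (by nlinarith [norm_nonneg z]) (by positivity)

theorem continuous_poisson {z : ℂ} (hz : ‖z‖ < 1) : Continuous (poisson z) :=
  Continuous.div (by fun_prop) (by fun_prop) fun w =>
    pow_ne_zero 2 (norm_ne_zero_iff.2 (coe_sub_ne_zero w hz))

theorem integral_poisson {z : ℂ} (hz : ‖z‖ < 1) : ∫ w, poisson z w ∂arcLength = 1 := by
  have h := DiffContOnCl.circleAverage_poissonKernel_smul' (R := 1) (w := z) (c := 0)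
    (diffContOnCl_const (c := (1 : ℂ))) (by simpa using hz)
  rw [← integral_arcLength (f := fun w => poisson z w • (1 : ℂ))
    ((continuous_poisson hz).smul continuous_const).aestronglyMeasurable, integral_smul_const] at h
  · simpa using h
  · intro w
    simp [poisson, Circle.norm_coe]

theorem norm_mul_circle_lt_one {r : ℝ} (hr0 : 0 ≤ r) (hr1 : r < 1) (ζ : Circle) :
    ‖(r : ℂ) * ζ‖ < 1 := by
  rwa [norm_mul, Circle.norm_coe, mul_one, Complex.norm_of_nonneg hr0]

/-- `|w - rζ| = |ζ - rw|` on the circle. -/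
theorem poisson_mul_comm (r : ℝ) (ζ w : Circle) :
    poisson (r * ζ) w = poisson (r * w) ζ := by
  have hw : Complex.normSq w = 1 := Circle.normSq_coe w
  have hζ : Complex.normSq ζ = 1 := Circle.normSq_coe ζ
  simp only [poisson, ← Complex.normSq_eq_norm_sq, Complex.normSq_mul, hw, hζ]
  congr 1
  simp only [Complex.normSq_apply] at *
  simp only [Complex.sub_re, Complex.sub_im, Complex.mul_re, Complex.mul_im, Complex.ofReal_re,
      Complex.ofReal_im, zero_mul, sub_zero, add_zero]
  linear_combination (1 - r ^ 2) * hw - (1 - r ^ 2) * hζ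

/-- The Poisson integral of `f` restricted to the circle of radius `r`, as a function on the unit
circle. -/
noncomputable def poissonMean (f : Circle → ℂ) (r : ℝ) (ζ : Circle) : ℂ :=
  ∫ w, poisson (r * ζ) w • f w ∂arcLength

theorem continuous_poisson_uncurry {r : ℝ} (hr0 : 0 ≤ r) (hr1 : r < 1) :
    Continuous fun p : Circle × Circle => poisson (r * p.1) p.2 :=
  Continuous.div (by fun_prop) (by fun_prop) fun p =>
    pow_ne_zero 2 (norm_ne_zero_iff.2 (coe_sub_ne_zero p.2 (norm_mul_circle_lt_one hr0 hr1 p.1)))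

theorem lintegral_enorm_poisson {z : ℂ} (hz : ‖z‖ < 1) :
    ∫⁻ w, ‖poisson z w‖ₑ ∂arcLength = 1 := by
  have hi : Integrable (poisson z) arcLength := by
    by_contra h
    have := integral_poisson hz
    rw [integral_undef h] at this
    exact zero_ne_one this
  have := ofReal_integral_eq_lintegral_ofReal hi (.of_forall (poisson_nonneg hz))
  rw [integral_poisson hz, ENNReal.ofReal_one] at this
  rw [this]
  congr with w
  exact Real.enorm_of_nonneg (poisson_nonneg hz w)

/-- Poisson means contract the `L¹` norm: by Tonelli's theorem and the symmetry of the kernel. -/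
theorem eLpNorm_poissonMean_le {f : Circle → ℂ} (hf : AEStronglyMeasurable f arcLength) {r : ℝ}
    (hr0 : 0 ≤ r) (hr1 : r < 1) :
    eLpNorm (poissonMean f r) 1 arcLength ≤ eLpNorm f 1 arcLength := by
  rw [eLpNorm_one_eq_lintegral_enorm, eLpNorm_one_eq_lintegral_enorm]
  calc ∫⁻ ζ, ‖poissonMean f r ζ‖ₑ ∂arcLength
      ≤ ∫⁻ ζ, ∫⁻ w, ‖poisson (r * ζ) w‖ₑ * ‖f w‖ₑ ∂arcLength ∂arcLength := by
        refine lintegral_mono fun ζ => (enorm_integral_le_lintegral_enorm _).trans_eq ?_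
        simp only [enorm_smul]
    _ = ∫⁻ w, ∫⁻ ζ, ‖poisson (r * ζ) w‖ₑ * ‖f w‖ₑ ∂arcLength ∂arcLength := by
        refine lintegral_lintegral_swap ?_
        exact (continuous_poisson_uncurry hr0 hr1).enorm.aemeasurable.mul hf.enorm.comp_snd
    _ = ∫⁻ w, ‖f w‖ₑ ∂arcLength := by
        congr with w
        rw [lintegral_mul_const'' _ (by
          exact ((continuous_poisson_uncurry hr0 hr1).comp
            (continuous_id.prodMk continuous_const)).enorm.aemeasurable)]
        simp only [poisson_mul_comm r _ w]
        rw [lintegral_enorm_poisson (norm_mul_circle_lt_one hr0 hr1 w), one_mul]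

theorem aestronglyMeasurable_poissonMean {f : Circle → ℂ} (hf : AEStronglyMeasurable f arcLength)
    {r : ℝ} (hr0 : 0 ≤ r) (hr1 : r < 1) :
    AEStronglyMeasurable (poissonMean f r) arcLength :=
  AEStronglyMeasurable.integral_prod_right'
    (f := fun p : Circle × Circle => poisson (r * p.1) p.2 • f p.2)
    ((continuous_poisson_uncurry hr0 hr1).aestronglyMeasurable.smul hf.comp_snd)

theorem integrable_poisson_smul {f : Circle → ℂ} (hf : Integrable f arcLength) {z : ℂ}
    (hz : ‖z‖ < 1) : Integrable (fun w => poisson z w • f w) arcLength := by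
  simp only [Complex.real_smul]
  exact integrable_continuous_mul hf (Complex.continuous_ofReal.comp (continuous_poisson hz))

/-! ### Convergence of Poisson means in the mean -/

theorem poissonMean_sub {f g : Circle → ℂ} (hf : Integrable f arcLength)
    (hg : Integrable g arcLength) {r : ℝ} (hr0 : 0 ≤ r) (hr1 : r < 1) :
    poissonMean (f - g) r = poissonMean f r - poissonMean g r := by
  ext ζ
  have hz := norm_mul_circle_lt_one hr0 hr1 ζ
  simp only [poissonMean, Pi.sub_apply, smul_sub]
  exact integral_sub (integrable_poisson_smul hf hz) (integrable_poisson_smul hg hz)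

theorem Ico_mem_nhdsLT_one : Set.Ico (0 : ℝ) 1 ∈ 𝓝[<] (1 : ℝ) := Ico_mem_nhdsLT one_pos

/-- The Poisson kernels concentrate at `ζ` as `r → 1`. -/
theorem tendsto_poissonMean_of_continuous {g : Circle → ℂ} (hg : Continuous g) (ζ : Circle) :
    Tendsto (fun r => poissonMean g r ζ) (𝓝[<] 1) (𝓝 (g ζ)) := by
  have hgi : Integrable g arcLength := by
    simpa using integrable_continuous_mul (integrable_const (1 : ℂ)) hg
  have := tendsto_setIntegral_peak_smul_of_integrableOn_of_tendsto (μ := arcLength)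
    (s := Set.univ) (t := Set.univ) (x₀ := ζ) (g := g) (a := g ζ) (l := 𝓝[<] (1 : ℝ))
    (φ := fun r w => poisson (r * ζ) w) MeasurableSet.univ MeasurableSet.univ subset_rfl
    univ_mem (measure_ne_top _ _) ?_ ?_ ?_ ?_ hgi.integrableOn
    (hg.continuousAt.mono_left nhdsWithin_le_nhds)
  · simpa [poissonMean] using this
  · filter_upwards [Ico_mem_nhdsLT_one] with r hr w _
    exact poisson_nonneg (norm_mul_circle_lt_one hr.1 hr.2 ζ) w
  · intro u hu hζu
    obtain ⟨d, hd, hball⟩ := Metric.isOpen_iff.1 hu ζ hζu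
    rw [Metric.tendstoUniformlyOn_iff]
    intro ε hε
    have h1 : Tendsto (fun r : ℝ => (1 - r ^ 2) / (d / 2) ^ 2) (𝓝[<] 1) (𝓝 0) := by
      have : Tendsto (fun r : ℝ => (1 - r ^ 2) / (d / 2) ^ 2) (𝓝 1)
          (𝓝 ((1 - 1 ^ 2) / (d / 2) ^ 2)) :=
        Continuous.tendsto (by fun_prop) 1
      simpa using this.mono_left nhdsWithin_le_nhds
    have h2 : ∀ᶠ r : ℝ in 𝓝[<] 1, 1 - d / 2 < r :=
      mem_nhdsWithin_of_mem_nhds (lt_mem_nhds (by linarith))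
    filter_upwards [Ico_mem_nhdsLT_one, h1.eventually_lt_const hε, h2] with r hr hrε hrd w hw
    have hz := norm_mul_circle_lt_one hr.1 hr.2 ζ
    have hdw : d ≤ ‖(w : ℂ) - ζ‖ := by
      rw [← circle_dist_eq_norm_sub]
      by_contra hlt
      exact hw.2 (hball (not_le.1 hlt))
    have hrζ : ‖(ζ : ℂ) - r * ζ‖ = 1 - r := by
      rw [show (ζ : ℂ) - r * ζ = ((1 - r : ℝ) : ℂ) * ζ by push_cast; ring, norm_mul,
        Circle.norm_coe, mul_one, Complex.norm_of_nonneg (by linarith [hr.2])]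
    have hden : d / 2 ≤ ‖(w : ℂ) - r * ζ‖ := by
      have := norm_sub_le_norm_sub_add_norm_sub (w : ℂ) (r * ζ) ζ
      rw [norm_sub_rev ((r : ℂ) * ζ) (ζ : ℂ), hrζ] at this
      linarith
    rw [Pi.zero_apply, dist_zero_left, Real.norm_of_nonneg (poisson_nonneg hz w)]
    refine lt_of_le_of_lt ?_ hrε
    rw [poisson, norm_mul, Circle.norm_coe, mul_one, Complex.norm_of_nonneg hr.1]
    have : 0 ≤ 1 - r ^ 2 := by nlinarith [hr.1, hr.2]
    gcongr
  · refine tendsto_const_nhds.congr' ?_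
    filter_upwards [Ico_mem_nhdsLT_one] with r hr
    rw [setIntegral_univ, integral_poisson (norm_mul_circle_lt_one hr.1 hr.2 ζ)]
  · filter_upwards [Ico_mem_nhdsLT_one] with r hr
    exact (continuous_poisson (norm_mul_circle_lt_one hr.1 hr.2 ζ)).aestronglyMeasurable

theorem norm_poissonMean_le {g : Circle → ℂ} {C : ℝ} (hC : ∀ w, ‖g w‖ ≤ C) {r : ℝ}
    (hr0 : 0 ≤ r) (hr1 : r < 1) (ζ : Circle) : ‖poissonMean g r ζ‖ ≤ C := by
  have hz := norm_mul_circle_lt_one hr0 hr1 ζ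
  have hi : Integrable (poisson (r * ζ)) arcLength :=
    (continuous_poisson hz).integrable_of_hasCompactSupport (HasCompactSupport.of_compactSpace _)
  calc ‖poissonMean g r ζ‖ ≤ ∫ w, poisson (r * ζ) w * C ∂arcLength := by
        refine norm_integral_le_of_norm_le (hi.mul_const C) (.of_forall fun w => ?_)
        rw [norm_smul, Real.norm_of_nonneg (poisson_nonneg hz w)]
        exact mul_le_mul_of_nonneg_left (hC w) (poisson_nonneg hz w)
    _ = C := by rw [integral_mul_const, integral_poisson hz, one_mul]

theorem tendsto_eLpNorm_poissonMean_sub_of_continuous {g : Circle → ℂ} (hg : Continuous g) :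
    Tendsto (fun r => eLpNorm (poissonMean g r - g) 1 arcLength) (𝓝[<] 1) (𝓝 0) := by
  obtain ⟨C, hC⟩ := isCompact_univ.exists_bound_of_continuousOn hg.continuousOn
  have hC' : ∀ w, ‖g w‖ ≤ C := fun w => hC w trivial
  simp only [eLpNorm_one_eq_lintegral_enorm]
  rw [← lintegral_zero (μ := arcLength) (α := Circle)]
  refine tendsto_lintegral_filter_of_dominated_convergence' (fun _ => ENNReal.ofReal (C + C)) ?_ ?_
    (by simp) (.of_forall fun ζ => ?_)
  · filter_upwards [Ico_mem_nhdsLT_one] with r hr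
    exact ((aestronglyMeasurable_poissonMean hg.aestronglyMeasurable hr.1 hr.2).sub
      hg.aestronglyMeasurable).enorm
  · filter_upwards [Ico_mem_nhdsLT_one] with r hr
    refine .of_forall fun ζ => ?_
    rw [← ofReal_norm]
    refine ENNReal.ofReal_le_ofReal ((norm_sub_le _ _).trans ?_)
    exact add_le_add (norm_poissonMean_le hC' hr.1 hr.2 ζ) (hC' ζ)
  · have := ((tendsto_poissonMean_of_continuous hg ζ).sub_const (g ζ)).enorm
    simpa using this

/-- Continuous functions are dense in `L¹` and Poisson means are contractions. -/
theorem tendsto_eLpNorm_poissonMean_sub {f : Circle → ℂ} (hf : Integrable f arcLength) :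
    Tendsto (fun r => eLpNorm (poissonMean f r - f) 1 arcLength) (𝓝[<] 1) (𝓝 0) := by
  rw [ENNReal.tendsto_nhds_zero]
  intro ε hε
  obtain ⟨δ, hδ, hδε⟩ : ∃ δ : ℝ≥0∞, δ ≠ 0 ∧ δ + δ + δ ≤ ε :=
    ⟨ε / 3, by simpa using hε.ne', (ENNReal.add_thirds ε).le⟩
  obtain ⟨g, hgc, hfg, hgi⟩ : ∃ g : Circle → ℂ, Continuous g ∧
      ∫⁻ w, ‖f w - g w‖ₑ ∂arcLength ≤ δ ∧ Integrable g arcLength := by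
    obtain ⟨g, hg⟩ := hf.exists_boundedContinuous_lintegral_sub_le hδ
    exact ⟨g, g.continuous, hg⟩
  have hfg' : eLpNorm (f - g) 1 arcLength ≤ δ := by
    rwa [eLpNorm_one_eq_lintegral_enorm]
  have hgt := (ENNReal.tendsto_nhds_zero.1
    (tendsto_eLpNorm_poissonMean_sub_of_continuous hgc)) δ (pos_iff_ne_zero.2 hδ)
  filter_upwards [Ico_mem_nhdsLT_one, hgt] with r hr hgr
  have hd := hf.sub hgi
  have hdm := hd.aestronglyMeasurable
  have h1 : poissonMean f r - f =
      poissonMean (f - g) r + (poissonMean g r - g) + -(f - g) := by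
    rw [poissonMean_sub hf hgi hr.1 hr.2]; abel
  have m1 := aestronglyMeasurable_poissonMean hdm hr.1 hr.2
  have m2 := (aestronglyMeasurable_poissonMean hgi.aestronglyMeasurable hr.1 hr.2).sub
    hgi.aestronglyMeasurable
  rw [h1]
  calc _ ≤ eLpNorm (poissonMean (f - g) r + (poissonMean g r - g)) 1 arcLength
        + eLpNorm (-(f - g)) 1 arcLength := eLpNorm_add_le (m1.add m2) hdm.neg le_rfl
    _ ≤ eLpNorm (poissonMean (f - g) r) 1 arcLength + eLpNorm (poissonMean g r - g) 1 arcLength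
        + eLpNorm (-(f - g)) 1 arcLength := by gcongr; exact eLpNorm_add_le m1 m2 le_rfl
    _ ≤ δ + δ + δ := by
        rw [eLpNorm_neg]
        gcongr
        exact (eLpNorm_poissonMean_le hdm hr.1 hr.2).trans hfg'
    _ ≤ ε := hδε

/-! ### Poisson integrals that are Cauchy integrals -/

/-- The splitting of the Poisson kernel into an analytic part in `z` and an antianalytic part. -/
theorem poisson_eq (z : ℂ) (hz : ‖z‖ < 1) (w : Circle) :
    (poisson z w : ℂ) = w / (w - z) + (starRingEnd ℂ z * w) / (1 - starRingEnd ℂ z * w) := by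
  have hw : (w : ℂ) * starRingEnd ℂ w = 1 := by
    rw [Complex.mul_conj, Circle.normSq_coe, Complex.ofReal_one]
  have h1 := coe_sub_ne_zero w hz
  have h2 : (1 : ℂ) - starRingEnd ℂ z * w ≠ 0 := fun h => by
    have := congrArg norm (sub_eq_zero.1 h)
    rw [norm_mul, Circle.norm_coe, mul_one, RCLike.norm_conj, norm_one] at this
    exact hz.ne this.symm
  have h3 : (‖(w : ℂ) - z‖ ^ 2 : ℂ) = (w - z) * (starRingEnd ℂ w - starRingEnd ℂ z) := by
    rw [← map_sub, Complex.mul_conj, Complex.normSq_eq_norm_sq]; push_cast; rfl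
  have h4 : (‖z‖ ^ 2 : ℂ) = z * starRingEnd ℂ z := by
    rw [Complex.mul_conj, Complex.normSq_eq_norm_sq]; push_cast; rfl
  have h5 : (w : ℂ) * (starRingEnd ℂ w - starRingEnd ℂ z) = 1 - starRingEnd ℂ z * w := by
    linear_combination hw
  have h6 : (starRingEnd ℂ w - starRingEnd ℂ z) ≠ 0 := fun h => h2 (by rw [← h5, h, mul_zero])
  rw [poisson]
  push_cast
  rw [h3, h4, ← h5]
  have hw0 : (w : ℂ) ≠ 0 := Circle.coe_ne_zero w
  field_simp
  linear_combination (-1 : ℂ) * hw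

/-- When the positive powers are annihilated, so is the antianalytic part of the Poisson kernel, and
the Poisson integral becomes a Cauchy integral. -/
theorem AnnihilatesPowers.integral_poisson_smul {H : Circle → ℂ}
    (h : AnnihilatesPowers arcLength H) {z : ℂ} (hz : ‖z‖ < 1) :
    ∫ w, poisson z w • H w ∂arcLength = ∫ w : Circle, ((w : ℂ) / (w - z)) * H w ∂arcLength := by
  have hsecond : Integrable (fun w : Circle =>
      (starRingEnd ℂ z * w) / (1 - starRingEnd ℂ z * w) * H w) arcLength ∧
      ∫ w : Circle, (starRingEnd ℂ z * w) / (1 - starRingEnd ℂ z * w) * H w ∂arcLength = 0 := by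
    rcases eq_or_ne z 0 with rfl | hz0
    · simp
    have hc0 : starRingEnd ℂ z ≠ 0 := by simpa using hz0
    have hb : 1 < ‖(starRingEnd ℂ z)⁻¹‖ := by
      rw [norm_inv, RCLike.norm_conj]
      exact (one_lt_inv₀ (norm_pos_iff.2 hz0)).2 hz
    -- The antianalytic part has its only pole at `1 / conj z`, outside the closed disc.
    have h2 := h.inv_sub_mul hb
    have heq : (fun w : Circle => (starRingEnd ℂ z * w) / (1 - starRingEnd ℂ z * w) * H w) =
        fun w : Circle => -((w : ℂ) ^ (0 + 1) * (((w : ℂ) - (starRingEnd ℂ z)⁻¹)⁻¹ * H w)) := by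
      ext w
      have : (1 : ℂ) - starRingEnd ℂ z * w = -starRingEnd ℂ z * (w - (starRingEnd ℂ z)⁻¹) := by
        field_simp; ring
      rw [this, mul_div_mul_comm, div_neg, div_self hc0]
      ring
    rw [heq]
    constructor
    · exact (integrable_continuous_mul h2.integrable (g := fun w : Circle => (w : ℂ) ^ (0 + 1))
        (by fun_prop)).neg
    · rw [integral_neg, h2.integral_eq_zero, neg_zero]
  have hfirst : Integrable (fun w : Circle => ((w : ℂ) / (w - z)) * H w) arcLength :=
    integrable_continuous_mul h.integrable
      (Continuous.div (by fun_prop) (by fun_prop) fun w => coe_sub_ne_zero w hz)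
  rw [← add_zero (∫ w : Circle, ((w : ℂ) / (w - z)) * H w ∂arcLength), ← hsecond.2,
    ← integral_add hfirst hsecond.1]
  congr with w
  rw [Complex.real_smul, poisson_eq z hz, add_mul]

theorem analyticOnNhd_cauchyIntegral_arcLength {H : Circle → ℂ} (hH : Integrable H arcLength) :
    AnalyticOnNhd ℂ (fun z => ∫ w : Circle, ((w : ℂ) / (w - z)) * H w ∂arcLength)
      (Metric.ball 0 1) := by
  -- Circle integrals need an extension of `H` to the plane; its values off the circle are
  -- irrelevant.
  let F : ℂ → ℂ := fun ζ => H (Circle.exp ζ.arg)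
  have hF : ∀ w : Circle, F w = H w := fun w => by simp only [F, Circle.exp_arg]
  have h1 := (hasFPowerSeriesOn_cauchy_integral (R := 1)
    (by simpa using circleIntegrable_of_integrable_arcLength hH hF) one_pos).analyticOnNhd
  simp only [ENNReal.coe_one, NNReal.coe_one] at h1
  rw [← ENNReal.ofReal_one, Metric.eball_ofReal] at h1
  refine h1.congr Metric.isOpen_ball fun z hz => ?_
  have hz' : ‖z‖ < 1 := by simpa using hz
  have hm : AEStronglyMeasurable (fun w : Circle => ((w : ℂ) / (w - z)) * H w) arcLength :=
    (integrable_continuous_mul hH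
      (Continuous.div (by fun_prop) (by fun_prop)
        fun w => coe_sub_ne_zero w hz')).aestronglyMeasurable
  rw [integral_arcLength hm (F := fun ζ => (ζ / (ζ - z)) * F ζ) (fun w => by simp only [hF]),
    Real.circleAverage_eq_circleIntegral one_ne_zero]
  congr 1
  refine circleIntegral.integral_congr zero_le_one fun ζ hζ => ?_
  have hζ0 : ζ ≠ 0 := by
    rintro rfl
    simp at hζ
  simp only [smul_eq_mul, sub_zero]
  field_simp

/-! ### The theorem of F. and M. Riesz -/

theorem fourierCoeffMeasure_withDensityᵥ {ν : Measure Circle} {h : Circle → ℂ}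
    (hh : Integrable h ν) (k : ℤ) :
    fourierCoeffMeasure (ν.withDensityᵥ h) k = ∫ w : Circle, (w : ℂ) ^ (-k) * h w ∂ν := by
  have hc : Continuous fun w : Circle => (w : ℂ) ^ (-k) :=
    Continuous.zpow₀ (by fun_prop) _ fun w => Or.inl (Circle.coe_ne_zero w)
  rw [fourierCoeffMeasure, integral_withDensityᵥ _ hh hc.stronglyMeasurable (C := 1)]
  · rfl
  · intro w
    rw [norm_zpow, Circle.norm_coe, one_zpow]

theorem poissonExtension_withDensityᵥ {f : Circle → ℂ} (hf : Integrable f arcLength) {z : ℂ}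
    (hz : ‖z‖ < 1) :
    poissonExtension (arcLength.withDensityᵥ f) z = ∫ w, poisson z w • f w ∂arcLength := by
  obtain ⟨C, hC⟩ := isCompact_univ.exists_bound_of_continuousOn (continuous_poisson hz).continuousOn
  exact integral_withDensityᵥ _ hf (continuous_poisson hz).stronglyMeasurable
    fun w => hC w trivial

theorem annihilatesPowers_of_fourierCoeffMeasure_eq_zero {ν : Measure Circle} {h : Circle → ℂ}
    (hh : Integrable h ν) (hμ : ∀ k : ℤ, k < 0 → fourierCoeffMeasure (ν.withDensityᵥ h) k = 0) :
    AnnihilatesPowers ν h := by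
  refine ⟨hh, fun n => ?_⟩
  have := hμ (-((n + 1 : ℕ) : ℤ)) (by omega)
  rw [fourierCoeffMeasure_withDensityᵥ hh, neg_neg] at this
  simpa only [zpow_natCast] using this

theorem absolutelyContinuous_arcLength (μ : ComplexMeasure Circle)
    (hμ : ∀ k : ℤ, k < 0 → fourierCoeffMeasure μ k = 0) :
    VectorMeasure.AbsolutelyContinuous μ arcLength.toENNRealVectorMeasure := by
  obtain ⟨ν, h, hν, hh, rfl⟩ := exists_eq_withDensityᵥ μ
  refine VectorMeasure.AbsolutelyContinuous.mk fun E hE hE0 => ?_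
  rw [Measure.toENNRealVectorMeasure_apply_measurable hE] at hE0
  rw [withDensityᵥ_apply hh hE]
  exact (annihilatesPowers_of_fourierCoeffMeasure_eq_zero hh hμ).setIntegral_eq_zero hE hE0

theorem circleRestriction_poissonExtension {f : Circle → ℂ} (hf : Integrable f arcLength) {r : ℝ}
    (hr0 : 0 ≤ r) (hr1 : r < 1) :
    circleRestriction (poissonExtension (arcLength.withDensityᵥ f)) r = poissonMean f r := by
  ext ζ
  exact poissonExtension_withDensityᵥ hf (norm_mul_circle_lt_one hr0 hr1 ζ)

theorem AnnihilatesPowers.memHardyOne_poissonExtension {f : Circle → ℂ}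
    (h : AnnihilatesPowers arcLength f) :
    MemHardyOne (poissonExtension (arcLength.withDensityᵥ f)) := by
  refine ⟨(analyticOnNhd_cauchyIntegral_arcLength h.integrable).congr Metric.isOpen_ball
    fun z hz => ?_, (eLpNorm f 1 arcLength).toNNReal, fun r hr0 hr1 => ?_⟩
  · have hz' : ‖z‖ < 1 := by simpa using hz
    rw [poissonExtension_withDensityᵥ h.integrable hz', h.integral_poisson_smul hz']
  · rw [circleRestriction_poissonExtension h.integrable hr0 hr1,
      ENNReal.coe_toNNReal (memLp_one_iff_integrable.2 h.integrable).eLpNorm_ne_top]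
    exact eLpNorm_poissonMean_le h.integrable.aestronglyMeasurable hr0 hr1

theorem exists_forall_eLpNorm_poissonMean_sub_lt {f : Circle → ℂ} (hf : Integrable f arcLength)
    {ε : ℝ≥0∞} (hε : 0 < ε) : ∃ R : ℝ, 0 ≤ R ∧ R < 1 ∧ ∀ r ρ : ℝ, R ≤ r → r < 1 → R ≤ ρ → ρ < 1 →
      eLpNorm (poissonMean f r - poissonMean f ρ) 1 arcLength < ε := by
  have hev : ∀ᶠ r in 𝓝[<] (1 : ℝ), eLpNorm (poissonMean f r - f) 1 arcLength < ε / 2 :=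
    (tendsto_eLpNorm_poissonMean_sub hf).eventually_lt_const (ENNReal.half_pos hε.ne')
  obtain ⟨R, hR1, hR⟩ := (mem_nhdsLT_iff_exists_Ico_subset).1
    (hev.and Ico_mem_nhdsLT_one)
  have hR1 : R < 1 := hR1
  refine ⟨R, (hR ⟨le_rfl, hR1⟩).2.1, hR1, fun r ρ hr hr1 hρ hρ1 => ?_⟩
  obtain ⟨h1, hr'⟩ := hR ⟨hr, hr1⟩
  obtain ⟨h2, hρ'⟩ := hR ⟨hρ, hρ1⟩
  have hfm := hf.aestronglyMeasurable
  calc eLpNorm (poissonMean f r - poissonMean f ρ) 1 arcLength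
      = eLpNorm ((poissonMean f r - f) - (poissonMean f ρ - f)) 1 arcLength := by
        rw [sub_sub_sub_cancel_right]
    _ ≤ eLpNorm (poissonMean f r - f) 1 arcLength + eLpNorm (poissonMean f ρ - f) 1 arcLength :=
        eLpNorm_sub_le ((aestronglyMeasurable_poissonMean hfm hr'.1 hr'.2).sub hfm)
          ((aestronglyMeasurable_poissonMean hfm hρ'.1 hρ'.2).sub hfm) le_rfl
    _ < ε / 2 + ε / 2 := ENNReal.add_lt_add h1 h2
    _ = ε := ENNReal.add_halves ε

end FMRiesz

theorem mainTheorem2 (μ : ComplexMeasure Circle)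
    (hμ : ∀ k : ℤ, k < 0 → FMRiesz.fourierCoeffMeasure μ k = 0) :
    VectorMeasure.AbsolutelyContinuous μ FMRiesz.arcLength.toENNRealVectorMeasure ∧
    FMRiesz.MemHardyOne (FMRiesz.poissonExtension μ) ∧
    (∀ ε : ℝ≥0∞, 0 < ε → ∃ R : ℝ, 0 ≤ R ∧ R < 1 ∧
      ∀ r ρ : ℝ, R ≤ r → r < 1 → R ≤ ρ → ρ < 1 →
        eLpNorm (FMRiesz.circleRestriction (FMRiesz.poissonExtension μ) r -
          FMRiesz.circleRestriction (FMRiesz.poissonExtension μ) ρ) 1 FMRiesz.arcLength < ε) ∧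
    ∃ f : Circle → ℂ, Integrable f FMRiesz.arcLength ∧
      Tendsto (fun r : ℝ =>
          eLpNorm (FMRiesz.circleRestriction (FMRiesz.poissonExtension μ) r - f)
            1 FMRiesz.arcLength) (𝓝[<] 1) (𝓝 0) ∧
      (∀ k : ℤ, FMRiesz.fourierCoeffFun f k = FMRiesz.fourierCoeffMeasure μ k) ∧
      μ = FMRiesz.arcLength.withDensityᵥ f := by
  have hac := FMRiesz.absolutelyContinuous_arcLength μ hμ
  obtain ⟨f, hf, rfl⟩ : ∃ f : Circle → ℂ, Integrable f FMRiesz.arcLength ∧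
      μ = FMRiesz.arcLength.withDensityᵥ f :=
    ⟨_, μ.integrable_rnDeriv _, (FMRiesz.withDensityᵥ_rnDeriv_eq μ _ hac).symm⟩
  refine ⟨hac, (FMRiesz.annihilatesPowers_of_fourierCoeffMeasure_eq_zero hf
    hμ).memHardyOne_poissonExtension, fun ε hε => ?_, f, hf, ?_, fun k => ?_, rfl⟩
  · obtain ⟨R, hR0, hR1, hR⟩ := FMRiesz.exists_forall_eLpNorm_poissonMean_sub_lt hf hε
    refine ⟨R, hR0, hR1, fun r ρ hr hr1 hρ hρ1 => ?_⟩
    rw [FMRiesz.circleRestriction_poissonExtension hf (hR0.trans hr) hr1,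
      FMRiesz.circleRestriction_poissonExtension hf (hR0.trans hρ) hρ1]
    exact hR r ρ hr hr1 hρ hρ1
  · refine (FMRiesz.tendsto_eLpNorm_poissonMean_sub hf).congr' ?_
    filter_upwards [FMRiesz.Ico_mem_nhdsLT_one] with r hr
    rw [FMRiesz.circleRestriction_poissonExtension hf hr.1 hr.2]
  · rw [FMRiesz.fourierCoeffMeasure_withDensityᵥ hf]
    rfl
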